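/- Let $m,n\ge 0$ be integers with $m\ge n+1$. Let $\mathbb H^n=\mathbb R^n\times\mathbb R^n\times\mathbb R$ be the Heisenberg group with the group law $$(x,y,t)*(x',y',t')=\Big(x+x',\,y+y',\,t+t'+2\sum_{j=1}^n(y_jx_j'-x_jy_j')\Big),$$ regarded as a metric space with the Korányi metric $d_K(p,q)=\|q^{-1}*p\|_K$, where $\|(x,y,t)\|_K=\big((|x|^2+|y|^2)^2+t^2\big)^{1/4}$. Let $\mathbb B^m$ be the unit ball of $\mathbb R^m$, open or closed. Then there is no topological embedding $f:\mathbb B^m\to\mathbb H^n$ such that 1. $f\in C^{0,\frac12+}(\mathbb B^m,\mathbb H^n)$, i.e. $$\lim_{t\to0^+}\ \sup\left\{\frac{d_K(f(x),f(y))}{|x-y|^{1/2}}:\ x,y\in\mathbb B^m,\ 0<|x-y|\le t\right\}=0,$$ and 2. $f\in C^{0,1}(\mathbb B^m,\mathbb R^{2n+1})$, i.e. $f$, as a map into $\mathbb R^{2n+1}$ with the Euclidean metric, is Lipschitz continuous. -/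

import Mathlib

open Metric Filter Topology
open scoped NNReal ENNReal

/-- The set of points of the Heisenberg group `ℍⁿ = ℝⁿ × ℝⁿ × ℝ`, with coordinates `(x, y, t)`. -/
@[ext]
structure Heisenberg (n : ℕ) where
  x : EuclideanSpace ℝ (Fin n)
  y : EuclideanSpace ℝ (Fin n)
  t : ℝ

namespace Heisenberg

variable {n : ℕ}

/-- The group law
`(x,y,t) * (x',y',t') = (x + x', y + y', t + t' + 2 ∑ⱼ (yⱼ x'ⱼ - xⱼ y'ⱼ))`. -/
noncomputable instance : Mul (Heisenberg n) :=
  ⟨fun p q => ⟨p.x + q.x, p.y + q.y, p.t + q.t + 2 * ∑ j, (p.y j * q.x j - p.x j * q.y j)⟩⟩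

noncomputable instance : One (Heisenberg n) := ⟨⟨0, 0, 0⟩⟩

noncomputable instance : Inv (Heisenberg n) := ⟨fun p => ⟨-p.x, -p.y, -p.t⟩⟩

@[simp] theorem mul_x (p q : Heisenberg n) : (p * q).x = p.x + q.x := rfl
@[simp] theorem mul_y (p q : Heisenberg n) : (p * q).y = p.y + q.y := rfl
@[simp] theorem mul_t (p q : Heisenberg n) :
    (p * q).t = p.t + q.t + 2 * ∑ j, (p.y j * q.x j - p.x j * q.y j) := rfl
@[simp] theorem one_x : (1 : Heisenberg n).x = 0 := rfl
@[simp] theorem one_y : (1 : Heisenberg n).y = 0 := rfl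
@[simp] theorem one_t : (1 : Heisenberg n).t = 0 := rfl
@[simp] theorem inv_x (p : Heisenberg n) : p⁻¹.x = -p.x := rfl
@[simp] theorem inv_y (p : Heisenberg n) : p⁻¹.y = -p.y := rfl
@[simp] theorem inv_t (p : Heisenberg n) : p⁻¹.t = -p.t := rfl

noncomputable instance : Group (Heisenberg n) where
  mul_assoc p q r := by
    ext j
    · simp [add_assoc]
    · simp [add_assoc]
    · simp only [mul_t, mul_x, mul_y, PiLp.add_apply, add_mul, mul_add, Finset.sum_sub_distrib,
        Finset.sum_add_distrib]
      ring
  one_mul p := by ext j <;> simp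
  mul_one p := by ext j <;> simp
  inv_mul_cancel p := by
    ext j
    · simp
    · simp
    · simp [mul_comm]

/-- The Korányi gauge `‖(x,y,t)‖_K = (|(x,y)|⁴ + t²)^{1/4}`, where `|(x,y)|² = |x|² + |y|²`. -/
noncomputable def gauge (p : Heisenberg n) : ℝ :=
  ((‖p.x‖ ^ 2 + ‖p.y‖ ^ 2) ^ 2 + p.t ^ 2) ^ (1 / 4 : ℝ)

theorem gauge_nonneg (p : Heisenberg n) : 0 ≤ gauge p := by
  unfold gauge; positivity

theorem gauge_pow_four (p : Heisenberg n) :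
    gauge p ^ 4 = (‖p.x‖ ^ 2 + ‖p.y‖ ^ 2) ^ 2 + p.t ^ 2 := by
  unfold gauge
  rw [← Real.rpow_natCast, ← Real.rpow_mul (by positivity)]
  norm_num

theorem gauge_inv (p : Heisenberg n) : gauge p⁻¹ = gauge p := by
  simp [gauge]

theorem gauge_one : gauge (1 : Heisenberg n) = 0 := by
  simp [gauge]

theorem eq_one_of_gauge_eq_zero {p : Heisenberg n} (h : gauge p = 0) : p = 1 := by
  have h4 := gauge_pow_four p
  rw [h] at h4
  have h1 : (‖p.x‖ ^ 2 + ‖p.y‖ ^ 2) ^ 2 = 0 := by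
    nlinarith [sq_nonneg (‖p.x‖ ^ 2 + ‖p.y‖ ^ 2), sq_nonneg p.t]
  have h2 : p.t ^ 2 = 0 := by
    nlinarith [sq_nonneg (‖p.x‖ ^ 2 + ‖p.y‖ ^ 2), sq_nonneg p.t]
  have h3 := pow_eq_zero_iff (two_ne_zero) |>.1 h1
  have hx : ‖p.x‖ ^ 2 = 0 := by nlinarith [sq_nonneg ‖p.x‖, sq_nonneg ‖p.y‖]
  have hy : ‖p.y‖ ^ 2 = 0 := by nlinarith [sq_nonneg ‖p.x‖, sq_nonneg ‖p.y‖]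
  ext1
  · simpa using hx
  · simpa using hy
  · simpa using h2

/-- Subadditivity of the Korányi gauge. -/
theorem gauge_mul_le (p q : Heisenberg n) : gauge (p * q) ≤ gauge p + gauge q := by
  have key : ∀ r : Heisenberg n,
      ‖(⟨‖r.x‖ ^ 2 + ‖r.y‖ ^ 2, r.t⟩ : ℂ)‖ = gauge r ^ 2 := by
    intro r
    refine (pow_left_inj₀ (norm_nonneg _) (by positivity) two_ne_zero).1 ?_
    rw [← pow_mul, gauge_pow_four, ← Complex.normSq_eq_norm_sq, Complex.normSq_mk]
    ring
  let z : Heisenberg n → EuclideanSpace ℂ (Fin n) :=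
    fun r => WithLp.toLp 2 fun j => (⟨r.x j, r.y j⟩ : ℂ)
  have hz : ∀ r, ‖z r‖ ^ 2 = ‖r.x‖ ^ 2 + ‖r.y‖ ^ 2 := by
    intro r
    simp only [z, EuclideanSpace.norm_sq_eq, ← Finset.sum_add_distrib]
    refine Finset.sum_congr rfl fun j _ => ?_
    rw [← Complex.normSq_eq_norm_sq, Complex.normSq_mk]
    simp [sq]
  have hzle : ∀ r, ‖z r‖ ≤ gauge r := by
    intro r
    refine le_of_pow_le_pow_left₀ (n := 4) (by norm_num) (gauge_nonneg r) ?_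
    rw [gauge_pow_four, show ‖z r‖ ^ 4 = (‖z r‖ ^ 2) ^ 2 by ring, hz]
    nlinarith [sq_nonneg r.t]
  have hsum : (⟨‖(p * q).x‖ ^ 2 + ‖(p * q).y‖ ^ 2, (p * q).t⟩ : ℂ) =
      ⟨‖p.x‖ ^ 2 + ‖p.y‖ ^ 2, p.t⟩ + ⟨‖q.x‖ ^ 2 + ‖q.y‖ ^ 2, q.t⟩
        + 2 * inner ℂ (z q) (z p) := by
    apply Complex.ext
    · simp only [mul_x, mul_y, EuclideanSpace.norm_sq_eq, z, PiLp.inner_apply, Complex.add_re,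
        ← Finset.sum_add_distrib, Complex.mul_re, Complex.re_sum, Finset.mul_sum]
      simp only [Complex.re_ofNat, Complex.im_ofNat, zero_mul, sub_zero, Finset.mul_sum,
        ← Finset.sum_add_distrib]
      refine Finset.sum_congr rfl fun j _ => ?_
      simp
      ring
    · simp only [mul_t, z, PiLp.inner_apply, Complex.add_im,
        Complex.mul_im, Complex.re_sum, Complex.im_sum]
      simp only [Complex.re_ofNat, Complex.im_ofNat, zero_mul, add_zero]
      congr 2
      refine Finset.sum_congr rfl fun j _ => ?_
      simp
      ring
  have h1 : gauge (p * q) ^ 2 ≤ (gauge p + gauge q) ^ 2 := by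
    rw [← key, hsum]
    refine (norm_add_le _ _).trans ?_
    have h2 : ‖(2 : ℂ) * inner ℂ (z q) (z p)‖ ≤ 2 * (gauge q * gauge p) := by
      rw [norm_mul]
      have := norm_inner_le_norm (𝕜 := ℂ) (z q) (z p)
      have h3 : ‖z q‖ * ‖z p‖ ≤ gauge q * gauge p :=
        mul_le_mul (hzle q) (hzle p) (norm_nonneg _) (gauge_nonneg q)
      simp only [Complex.norm_ofNat]
      linarith
    have h4 := norm_add_le (⟨‖p.x‖ ^ 2 + ‖p.y‖ ^ 2, p.t⟩ : ℂ) ⟨‖q.x‖ ^ 2 + ‖q.y‖ ^ 2, q.t⟩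
    rw [key, key] at h4
    nlinarith
  exact le_of_pow_le_pow_left₀ two_ne_zero (add_nonneg (gauge_nonneg p) (gauge_nonneg q)) h1

/-- `ℍⁿ` is a metric space with the Korányi metric `d_K(p, q) = ‖q⁻¹ * p‖_K`; its topology is the
metric topology. -/
noncomputable instance : MetricSpace (Heisenberg n) where
  dist p q := gauge (q⁻¹ * p)
  dist_self p := by simp [gauge_one]
  dist_comm p q := by
    rw [← gauge_inv (q⁻¹ * p)]
    simp
  dist_triangle p q r := by
    have := gauge_mul_le (r⁻¹ * q) (q⁻¹ * p)
    rw [show r⁻¹ * q * (q⁻¹ * p) = r⁻¹ * p by group] at this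
    linarith
  eq_of_dist_eq_zero {p q} h := (inv_mul_eq_one.1 (eq_one_of_gauge_eq_zero h)).symm

/-- The identity map `ℍⁿ → ℝ²ⁿ⁺¹`, `(x,y,t) ↦ (x,y,t)`, onto the Euclidean space, whose
coordinates are here indexed by `Fin n ⊕ Fin n ⊕ Unit`, a set of `2n + 1` elements. -/
noncomputable def toEuclidean (p : Heisenberg n) :
    EuclideanSpace ℝ (Fin n ⊕ Fin n ⊕ Unit) :=
  WithLp.toLp 2 (Sum.elim p.x (Sum.elim p.y fun _ => p.t))

end Heisenberg

/-- The class `C^{0,α}(X, Y)` of Hölder continuous maps: for some constant `C`,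
`d(f x, f y) ≤ C d(x, y)^α` for all `x, y`. -/
def IsHolder {X Y : Type*} [MetricSpace X] [MetricSpace Y] (α : ℝ≥0) (f : X → Y) : Prop :=
  ∃ C : ℝ≥0, HolderWith C α f

/-- The class `C^{0,α+}(X, Y)`: the supremum of `d(f x, f y) / d(x, y)^α` over all `x, y` with
`0 < d(x, y) ≤ t`, a number in `[0, ∞]`, tends to `0` as `t → 0⁺`. -/
def IsLittleHolder {X Y : Type*} [MetricSpace X] [MetricSpace Y] (α : ℝ) (f : X → Y) : Prop :=
  Tendsto
    (fun t : ℝ => ⨆ (x : X) (y : X) (_ : 0 < dist x y ∧ dist x y ≤ t),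
      ENNReal.ofReal (dist (f x) (f y) / dist x y ^ α))
    (𝓝[>] 0) (𝓝 0)

/-! Let F be f read in Euclidean coordinates, τ its last coordinate and ω = `contactForm`. The
squared Korányi distance dominates the vertical coordinate of q⁻¹ * p, so the little Hölder
condition says τ(x) − τ(y) + ω(F y, F x) = o(|x − y|) uniformly, a weak form of dτ = −ω(F, dF). By
Rademacher F is differentiable almost everywhere. For smooth F an exterior derivative would give
ω(DF a, DF b) = 0; here the same follows at each point of differentiability by summing increments
around a small triangle (`isotropic_fderiv_of_contact`). Isotropic subspaces of ℝ²ⁿ have dimension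
at most n < m, so the horizontal part of DF kills some v ≠ 0, and `contact_eq_of_hasFDerivAt` shows
that the vertical part kills it too.

A Lipschitz F with such derivatives is not injective on the closed ball
(`not_injOn_of_ae_fderiv_not_injective`). Otherwise, composing with a C¹ approximation of its
inverse gives a Lipschitz map close to the identity whose Jacobian vanishes almost everywhere, so
the image of the ball is null. Yet that image contains a neighbourhood of 0, by Brouwer's
no-retraction theorem for Lipschitz maps, which rests on the volume identity
`integral_det_one_add_fderiv`. -/

open MeasureTheory Module in
theorem LipschitzWith.hausdorffMeasure_image_null {E F : Type*} [MetricSpace E] [MeasurableSpace E]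
    [BorelSpace E] [MetricSpace F] [MeasurableSpace F] [BorelSpace F] {C : ℝ≥0} {f : E → F}
    (hf : LipschitzWith C f) {d : ℝ} (hd : 0 ≤ d) {s : Set E} (hs : μH[d] s = 0) :
    μH[d] (f '' s) = 0 := by
  have := hf.hausdorffMeasure_image_le hd s
  rw [hs, mul_zero] at this
  exact le_antisymm this zero_le

/-! ### Radial projections and Lipschitz estimates -/

section Lipschitz

variable {E : Type*} [NormedAddCommGroup E] [NormedSpace ℝ E]

/-- Used with c = 1 for the projection onto the ball, and with small c to normalise a map bounded
away from 0. -/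
theorem lipschitzWith_inv_max_norm_smul {c : ℝ} (hc : 0 < c) :
    LipschitzWith (Real.toNNReal (2 / c)) (fun x : E => (max c ‖x‖)⁻¹ • x) := by
  refine LipschitzWith.of_dist_le_mul fun x y => ?_
  rw [Real.coe_toNNReal _ (by positivity), dist_eq_norm, dist_eq_norm]
  set a := max c ‖x‖ with ha
  set b := max c ‖y‖ with hb
  have hac : c ≤ a := le_max_left _ _
  have hbc : c ≤ b := le_max_left _ _
  have hyb : ‖y‖ ≤ b := le_max_right _ _
  have ha0 : 0 < a := hc.trans_le hac
  have hb0 : 0 < b := hc.trans_le hbc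
  have hab : |b - a| ≤ ‖x - y‖ := by
    refine (abs_max_sub_max_le_max c ‖y‖ c ‖x‖).trans ?_
    simp only [sub_self, abs_zero]
    refine max_le (norm_nonneg _) ?_
    rw [norm_sub_rev]
    exact abs_norm_sub_norm_le y x
  have hsplit : a⁻¹ • x - b⁻¹ • y = a⁻¹ • (x - y) + ((b - a) * (a⁻¹ * b⁻¹)) • y := by
    have : (b - a) * (a⁻¹ * b⁻¹) = a⁻¹ - b⁻¹ := by field_simp
    rw [this]
    module
  rw [hsplit]
  refine (norm_add_le _ _).trans ?_
  rw [norm_smul, norm_smul, Real.norm_eq_abs, Real.norm_eq_abs, abs_mul, abs_of_pos (inv_pos.2 ha0),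
    abs_of_pos (by positivity : 0 < a⁻¹ * b⁻¹)]
  have h1 : a⁻¹ ≤ c⁻¹ := inv_anti₀ hc hac
  have h2 : b⁻¹ * ‖y‖ ≤ 1 := by
    rw [inv_mul_le_iff₀ hb0]; simpa using hyb
  calc a⁻¹ * ‖x - y‖ + |b - a| * (a⁻¹ * b⁻¹) * ‖y‖
      = a⁻¹ * ‖x - y‖ + |b - a| * a⁻¹ * (b⁻¹ * ‖y‖) := by ring
    _ ≤ c⁻¹ * ‖x - y‖ + ‖x - y‖ * c⁻¹ * 1 := by gcongr
    _ = 2 / c * ‖x - y‖ := by ring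

/-- The radial projection onto the closed unit ball. -/
noncomputable def unitBallProj (x : E) : E := (max 1 ‖x‖)⁻¹ • x

theorem lipschitzWith_unitBallProj : LipschitzWith 2 (unitBallProj : E → E) := by
  have h := lipschitzWith_inv_max_norm_smul (E := E) one_pos
  rwa [div_one, Real.toNNReal_ofNat] at h

theorem unitBallProj_of_norm_le {x : E} (hx : ‖x‖ ≤ 1) : unitBallProj x = x := by
  simp [unitBallProj, max_eq_left hx]

theorem norm_unitBallProj_of_le {x : E} (hx : 1 ≤ ‖x‖) : ‖unitBallProj x‖ = 1 := by
  have : ‖x‖ ≠ 0 := by positivity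
  simp [unitBallProj, max_eq_right hx, norm_smul, this]

theorem norm_unitBallProj_le (x : E) : ‖unitBallProj x‖ ≤ 1 := by
  have h0 : (0 : ℝ) < max 1 ‖x‖ := by positivity
  rw [unitBallProj, norm_smul, norm_inv, Real.norm_of_nonneg h0.le, inv_mul_le_iff₀ h0, mul_one]
  exact le_max_right _ _

theorem LipschitzWith.smul_of_bounded {X : Type*} [PseudoMetricSpace X] {f : X → ℝ} {g : X → E}
    {C D A B : ℝ≥0} (hf : LipschitzWith C f) (hg : LipschitzWith D g) (hA : ∀ x, ‖f x‖ ≤ A)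
    (hB : ∀ x, ‖g x‖ ≤ B) : LipschitzWith (A * D + C * B) (fun x => f x • g x) := by
  refine LipschitzWith.of_dist_le_mul fun x y => ?_
  rw [dist_eq_norm, show f x • g x - f y • g y = f x • (g x - g y) + (f x - f y) • g y by module]
  refine (norm_add_le _ _).trans ?_
  rw [norm_smul, norm_smul]
  have h1 := hg.dist_le_mul x y
  have h2 := hf.dist_le_mul x y
  rw [dist_eq_norm] at h1 h2
  push_cast
  calc ‖f x‖ * ‖g x - g y‖ + ‖f x - f y‖ * ‖g y‖
      ≤ A * (D * dist x y) + C * dist x y * B := by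
        gcongr
        · exact hA x
        · exact hB y
    _ = _ := by ring

end Lipschitz

/-- A bijection that is the identity outside the unit ball maps
the unit ball onto itself. -/
theorem image_ball_of_eq_id_outside {E : Type*} [NormedAddCommGroup E] {H : E → E} (hinj : Function.Injective H)
    (hsurj : Function.Surjective H) (hout : ∀ x, 1 ≤ ‖x‖ → H x = x) :
    H '' ball 0 1 = ball 0 1 := by
  ext y
  constructor
  · rintro ⟨x, hx, rfl⟩
    by_contra hy
    rw [mem_ball_zero_iff, not_lt] at hy
    have := hinj (hout _ hy)
    rw [this] at hy
    rw [mem_ball_zero_iff] at hx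
    linarith
  · intro hy
    obtain ⟨x, rfl⟩ := hsurj y
    refine ⟨x, ?_, rfl⟩
    by_contra hx
    rw [mem_ball_zero_iff, not_lt] at hx
    rw [hout x hx, mem_ball_zero_iff] at hy
    linarith

/-! ### The volume identity behind the degree argument -/

section Degree

open MeasureTheory Module

variable {E : Type*} [NormedAddCommGroup E] [NormedSpace ℝ E]

theorem exists_det_pos_near_one :
    ∃ δ > 0, ∀ A : E →L[ℝ] E, ‖A‖ < δ → 0 < (1 + A).det := by
  have hc : Continuous fun A : E →L[ℝ] E => (1 + A).det :=
    ContinuousLinearMap.continuous_det.comp (continuous_const.add continuous_id)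
  have h0 : (0 : ℝ) < (1 + (0 : E →L[ℝ] E)).det := by
    rw [add_zero]
    exact one_pos.trans_eq (LinearMap.det_id (A := ℝ) (M := E)).symm
  obtain ⟨δ, hδ, h⟩ := Metric.eventually_nhds_iff.1 (hc.continuousAt.eventually (lt_mem_nhds h0))
  exact ⟨δ, hδ, fun A hA => h (by rwa [dist_zero_right])⟩

variable [FiniteDimensional ℝ E]

/-- The determinant of 1 + tA is a polynomial in t of degree at most dim E, so Lagrange
interpolation recovers its value at t = 1 from the nodes, with weights independent of A. -/
theorem exists_det_one_add_smul_eq_sum (k : ℕ) (hk : finrank ℝ E ≤ k) {v : ℕ → ℝ}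
    (hv : Function.Injective v) :
    ∃ c : ℕ → ℝ, ∑ i ∈ Finset.range (k + 1), c i = 1 ∧ ∀ A : E →L[ℝ] E,
      (1 + A).det = ∑ i ∈ Finset.range (k + 1), c i * (1 + v i • A).det := by
  classical
  refine ⟨fun i => (Lagrange.basis (Finset.range (k + 1)) v i).eval 1, ?_, fun A => ?_⟩
  · rw [← Polynomial.eval_finsetSum, Lagrange.sum_basis hv.injOn (by simp), Polynomial.eval_one]
  · let b := finBasis ℝ E
    let M := LinearMap.toMatrix b b (A : E →ₗ[ℝ] E)
    let P : Polynomial ℝ :=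
      ((Polynomial.X : Polynomial ℝ) • M.map Polynomial.C + (1 : Matrix _ _ ℝ).map Polynomial.C).det
    have hdeg : P.degree < (Finset.range (k + 1)).card := by
      refine (Polynomial.degree_le_of_natDegree_le
        (Polynomial.natDegree_det_X_add_C_le M 1)).trans_lt ?_
      simp only [Fintype.card_fin, Finset.card_range]
      exact_mod_cast Nat.lt_succ_of_le hk
    have heval : ∀ t : ℝ, P.eval t = (1 + t • A).det := by
      intro t
      have h1 : P.eval t = (t • M + 1).det := by
        simp only [P]
        rw [← Polynomial.coe_evalRingHom, RingHom.map_det]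
        congr 1
        ext i j
        simp only [Matrix.one_apply, RingHom.mapMatrix_apply, Matrix.map_apply, Matrix.add_apply,
          Matrix.smul_apply, smul_eq_mul, map_add, Polynomial.coe_evalRingHom,
          Polynomial.eval_mul, Polynomial.eval_X, Polynomial.eval_C]
      rw [h1, ContinuousLinearMap.det, ← LinearMap.det_toMatrix b]
      congr 1
      simp [M, add_comm, LinearMap.toMatrix_one]
    have h2 := congrArg (Polynomial.eval 1) (Lagrange.eq_interpolate (f := P) hv.injOn hdeg)
    rw [heval, one_smul, Lagrange.interpolate_apply, Polynomial.eval_finsetSum] at h2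
    rw [h2]
    refine Finset.sum_congr rfl fun i _ => ?_
    rw [Polynomial.eval_mul, Polynomial.eval_C, heval, mul_comm]

variable [MeasurableSpace E] [BorelSpace E]

theorem integrableOn_det_one_add_smul_fderiv {g : E → E} {K : ℝ≥0} (hg : LipschitzWith K g)
    (t : ℝ) : IntegrableOn (fun x => (1 + t • fderiv ℝ g x).det) (ball 0 1) μH[finrank ℝ E] := by
  have hc : Continuous fun A : E →L[ℝ] E => (1 + t • A).det :=
    ContinuousLinearMap.continuous_det.comp (by fun_prop)
  obtain ⟨M, hM⟩ := ((isCompact_closedBall (0 : E →L[ℝ] E) K).image hc).isBounded.exists_norm_le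
  refine Measure.integrableOn_of_bounded (M := M) measure_ball_lt_top.ne ?_ ?_
  · exact (hc.measurable.comp (measurable_fderiv ℝ g)).aestronglyMeasurable
  · refine ae_of_all _ fun x => hM _ ⟨_, ?_, rfl⟩
    simpa using norm_fderiv_le_of_lipschitz ℝ hg

/-- For small t the map x + t g(x) is a bijection of the ball with positive Jacobian, so the change
of variables formula applies. -/
theorem exists_integral_det_one_add_smul_fderiv {g : E → E} {K : ℝ≥0} (hg : LipschitzWith K g)
    (hout : ∀ x, 1 ≤ ‖x‖ → g x = 0) : ∃ t₀ : ℝ, 0 < t₀ ∧ ∀ t : ℝ, 0 < t → t < t₀ →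
      ∫ x in ball 0 1, (1 + t • fderiv ℝ g x).det ∂μH[finrank ℝ E] =
        (μH[finrank ℝ E] : Measure E).real (ball 0 1) := by
  obtain ⟨δ, hδ, hdet⟩ := exists_det_pos_near_one (E := E)
  -- This forces tK < 1, for bijectivity, and tK < δ, for a positive determinant.
  refine ⟨min δ 1 / (K + 1), by positivity, fun t ht htt => ?_⟩
  have htK : t * (K + 1) < min δ 1 := (lt_div_iff₀ (by positivity)).1 htt
  have hK0 : (0 : ℝ) ≤ K := K.2
  set μ : Measure E := μH[finrank ℝ E]
  set H : E → E := fun x => x + t • g x with hH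
  have hnorm : ‖t‖₊ = ⟨t, ht.le⟩ := by
    ext
    exact abs_of_pos ht
  have hlip : LipschitzWith (⟨t, ht.le⟩ * K) (fun x => t • g x) := by
    have := (lipschitzWith_smul (α := ℝ) (β := E) t).comp hg
    rw [hnorm] at this
    exact this
  have happ : ApproximatesLinearOn H ((ContinuousLinearEquiv.refl ℝ E : E ≃L[ℝ] E) : E →L[ℝ] E)
      Set.univ (⟨t, ht.le⟩ * K) := by
    rw [ApproximatesLinearOn.approximatesLinearOn_iff_lipschitzOnWith, lipschitzOnWith_univ]
    convert hlip using 1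
    ext x
    simp [H]
  have hcc : Subsingleton E ∨ (⟨t, ht.le⟩ * K : ℝ≥0) <
      ‖((ContinuousLinearEquiv.refl ℝ E).symm : E →L[ℝ] E)‖₊⁻¹ := by
    rcases subsingleton_or_nontrivial E with h | h
    · exact Or.inl h
    · right
      have h1 : ‖((ContinuousLinearEquiv.refl ℝ E).symm : E →L[ℝ] E)‖₊ = 1 := by
        ext
        simp
      rw [h1, inv_one, ← NNReal.coe_lt_coe]
      push_cast
      have := min_le_right δ 1
      show t * K < 1
      nlinarith
  have himg : H '' ball 0 1 = ball 0 1 := by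
    refine image_ball_of_eq_id_outside (fun x y h => ?_) (happ.surjective hcc) fun x hx => ?_
    · exact happ.injOn hcc (Set.mem_univ _) (Set.mem_univ _) h
    · simp [H, hout x hx]
  set D : Set E := {x | DifferentiableAt ℝ g x}
  have hD : MeasurableSet D := measurableSet_of_differentiableAt ℝ g
  have hDc : μ Dᶜ = 0 := hg.ae_differentiableAt (μ := μ)
  have hHlip : LipschitzWith (1 + ⟨t, ht.le⟩ * K) H := LipschitzWith.id.add hlip
  have hnull : μ (H '' Dᶜ) = 0 := hHlip.hausdorffMeasure_image_null (by positivity) hDc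
  have hvol : μ (H '' (ball 0 1 ∩ D)) = μ (ball 0 1) := by
    refine le_antisymm ((measure_mono (Set.image_mono Set.inter_subset_left)).trans_eq
      (by rw [himg])) ?_
    calc μ (ball 0 1) = μ (H '' ball 0 1) := by rw [himg]
      _ ≤ μ (H '' (ball 0 1 ∩ D) ∪ H '' Dᶜ) := by
        rw [← Set.image_union]
        refine measure_mono (Set.image_mono fun x hx => ?_)
        by_cases h : x ∈ D
        · exact Or.inl ⟨hx, h⟩
        · exact Or.inr h
      _ ≤ _ := (measure_union_le _ _).trans (by rw [hnull, add_zero])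
  have hder : ∀ x ∈ ball 0 1 ∩ D,
      HasFDerivWithinAt H (1 + t • fderiv ℝ g x) (ball 0 1 ∩ D) x := fun x hx =>
    ((hasFDerivAt_id x).add (hx.2.hasFDerivAt.const_smul t)).hasFDerivWithinAt
  have harea := lintegral_abs_det_fderiv_eq_addHaar_image μ (measurableSet_ball.inter hD) hder
    (happ.injOn hcc |>.mono (Set.subset_univ _))
  rw [hvol] at harea
  have hpos : ∀ x, 0 < (1 + t • fderiv ℝ g x).det := by
    refine fun x => hdet _ ?_
    rw [norm_smul, Real.norm_eq_abs, abs_of_pos ht]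
    have h1 : ‖fderiv ℝ g x‖ ≤ K := norm_fderiv_le_of_lipschitz ℝ hg
    have h2 := min_le_left δ 1
    nlinarith
  have hae : (ball 0 1 ∩ D : Set E) =ᵐ[μ] (ball 0 1 : Set E) := by
    exact inter_ae_eq_left_of_ae_eq_univ (ae_eq_univ.2 hDc)
  rw [integral_eq_lintegral_of_nonneg_ae (ae_of_all _ fun x => (hpos x).le)
    (integrableOn_det_one_add_smul_fderiv hg t).1, measureReal_def, ← harea,
    setLIntegral_congr hae]
  simp_rw [abs_of_pos (hpos _)]
  rfl

/-- The integral with t • Dg is polynomial in t and constant for small t, hence has the same value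
at t = 1. -/
theorem integral_det_one_add_fderiv {g : E → E} {K : ℝ≥0} (hg : LipschitzWith K g)
    (hout : ∀ x, 1 ≤ ‖x‖ → g x = 0) :
    ∫ x in ball 0 1, (1 + fderiv ℝ g x).det ∂μH[finrank ℝ E] =
        (μH[finrank ℝ E] : Measure E).real (ball 0 1) := by
  obtain ⟨t₀, ht₀, h⟩ := exists_integral_det_one_add_smul_fderiv hg hout
  set v : ℕ → ℝ := fun i => t₀ / (i + 2) with hvdef
  have hv : Function.Injective v := by
    intro i j hij
    simp only [v] at hij
    rw [div_eq_div_iff (by positivity) (by positivity)] at hij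
    exact_mod_cast (add_right_cancel (mul_left_cancel₀ ht₀.ne' hij)).symm
  have hv1 : ∀ i, 0 < v i := fun i => by positivity
  have hv2 : ∀ i, v i < t₀ := fun i => by
    rw [div_lt_iff₀ (by positivity)]
    have : (0 : ℝ) ≤ i := i.cast_nonneg
    nlinarith
  obtain ⟨c, hc, hsum⟩ := exists_det_one_add_smul_eq_sum (E := E) _ le_rfl hv
  rw [show (fun x => (1 + fderiv ℝ g x).det) = _ from funext fun x => hsum (fderiv ℝ g x),
    integral_finsetSum _ fun i _ =>
    (integrableOn_det_one_add_smul_fderiv hg (v i)).const_mul (c i)]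
  simp_rw [integral_const_mul, h _ (hv1 _) (hv2 _)]
  rw [← Finset.sum_mul, hc, one_mul]

end Degree

/-! ### No retraction, and maps with degenerate derivative -/

section NoRetraction

open MeasureTheory Module

variable {E : Type*} [NormedAddCommGroup E] [InnerProductSpace ℝ E] [FiniteDimensional ℝ E]

/-- Differentiating ‖H‖² = 1 makes the range of A orthogonal to H x ≠ 0. -/
theorem det_fderiv_eq_zero_of_eventually_norm_eq_one {H : E → E} {A : E →L[ℝ] E} {x : E}
    (hA : HasFDerivAt H A x) (hH : ∀ᶠ y in 𝓝 x, ‖H y‖ = 1) : A.det = 0 := by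
  by_contra hdet
  have hzero : ∀ v, inner ℝ (H x) (A v) = 0 := by
    intro v
    have h1 := hA.norm_sq
    have h2 : HasFDerivAt (fun y => ‖H y‖ ^ 2) (0 : E →L[ℝ] ℝ) x :=
      (hasFDerivAt_const (1 : ℝ) x).congr_of_eventuallyEq (hH.mono fun y hy => by simp [hy])
    have h3 := congrArg (fun L : E →L[ℝ] ℝ => L v) (h1.unique h2)
    simpa using h3
  have hsurj : Function.Surjective A :=
    (LinearMap.equivOfDetNeZero (A : E →ₗ[ℝ] E) hdet).surjective
  obtain ⟨v, hv⟩ := hsurj (H x)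
  have h1 := hzero v
  rw [hv, real_inner_self_eq_norm_sq, hH.self_of_nhds] at h1
  norm_num at h1

variable [MeasurableSpace E] [BorelSpace E]

/-- There is no Lipschitz retraction of the closed unit ball onto the unit sphere. -/
theorem not_lipschitz_retraction {r : E → E} {C : ℝ≥0} (hr : LipschitzWith C r)
    (hsphere : ∀ x, ‖x‖ ≤ 1 → ‖r x‖ = 1) : ¬ ∀ x, ‖x‖ = 1 → r x = x := by
  intro hid
  set g : E → E := fun x => r (unitBallProj x) - unitBallProj x with hg
  have hglip : LipschitzWith _ g := (hr.comp lipschitzWith_unitBallProj).sub lipschitzWith_unitBallProj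
  have hint := integral_det_one_add_fderiv hglip fun x hx => by
    simp [g, hid _ (norm_unitBallProj_of_le hx)]
  have hzero : ∫ x in ball 0 1, (1 + fderiv ℝ g x).det ∂μH[finrank ℝ E] = 0 := by
    refine integral_eq_zero_of_ae ?_
    rw [Filter.EventuallyEq, ae_restrict_iff' measurableSet_ball]
    filter_upwards [hglip.ae_differentiableAt (μ := μH[finrank ℝ E])] with x hx hxb
    refine det_fderiv_eq_zero_of_eventually_norm_eq_one (H := fun y => y + g y)
      ((hasFDerivAt_id x).add hx.hasFDerivAt) ?_
    filter_upwards [isOpen_ball.mem_nhds hxb] with y hy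
    have hy1 : ‖y‖ ≤ 1 := (mem_ball_zero_iff.1 hy).le
    simp [g, unitBallProj_of_norm_le hy1, hsphere y hy1]
  rw [hint] at hzero
  have hpos : 0 < (μH[finrank ℝ E] : Measure E).real (ball 0 1) :=
    ENNReal.toReal_pos (measure_ball_pos _ _ one_pos).ne' measure_ball_lt_top.ne
  exact hpos.ne' hzero

/-- A Lipschitz map close to the identity on the closed unit ball has a zero there. -/
theorem exists_zero_of_norm_sub_le {h : E → E} {C : ℝ≥0} (hh : LipschitzWith C h)
    (hclose : ∀ x, ‖x‖ ≤ 1 → ‖h x - x‖ ≤ 1 / 4) : ∃ x, ‖x‖ ≤ 1 / 2 ∧ h x = 0 := by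
  by_contra! hne
  -- The cutoff is 1 for ‖x‖ ≤ 1/2 and 0 on the sphere. Thus H equals h on the half ball and the
  -- identity on the sphere; in between the perturbation is at most 1/4 < ‖x‖, so H has no zero.
  set φ : E → ℝ := fun x => max 0 (min 1 (2 * (1 - ‖x‖))) with hφ
  have hφ0 : ∀ x, 0 ≤ φ x := fun x => le_max_left _ _
  have hφ1 : ∀ x, φ x ≤ 1 := fun x => max_le zero_le_one (min_le_left _ _)
  have hφlip : LipschitzWith 2 φ := by
    have h1 : LipschitzWith 2 (fun x : E => 2 * (1 - ‖x‖)) := by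
      refine LipschitzWith.of_dist_le_mul fun x y => ?_
      rw [Real.dist_eq, show 2 * (1 - ‖x‖) - 2 * (1 - ‖y‖) = -(2 * (‖x‖ - ‖y‖)) by ring, abs_neg,
        abs_mul, dist_eq_norm, abs_two]
      have := abs_norm_sub_norm_le x y
      push_cast
      linarith
    exact (h1.const_min 1).const_max 0
  set H : E → E := fun x => unitBallProj x + φ (unitBallProj x) • (h (unitBallProj x) - unitBallProj x) with hH
  have hHlip : LipschitzWith _ H := lipschitzWith_unitBallProj.add
    ((hφlip.comp lipschitzWith_unitBallProj).smul_of_bounded (A := 1) (B := 1) ((hh.comp lipschitzWith_unitBallProj).sub lipschitzWith_unitBallProj)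
      (fun x => by exact (Real.norm_of_nonneg (hφ0 _)).trans_le (hφ1 _))
      (fun x => (hclose _ (norm_unitBallProj_le x)).trans (by norm_num)))
  have hHne : ∀ x, ‖x‖ ≤ 1 → H x ≠ 0 := by
    intro x hx
    simp only [H, unitBallProj_of_norm_le hx]
    by_cases hx2 : ‖x‖ ≤ 1 / 2
    · have : φ x = 1 := by
        simp only [φ]
        rw [min_eq_left (by linarith), max_eq_right zero_le_one]
      rw [this, one_smul, add_sub_cancel]
      exact hne x hx2
    · intro h0
      have h1 : ‖φ x • (h x - x)‖ ≤ 1 / 4 := by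
        rw [norm_smul, Real.norm_of_nonneg (hφ0 x)]
        exact (mul_le_of_le_one_left (norm_nonneg _) (hφ1 x)).trans (hclose x hx)
      rw [eq_neg_of_add_eq_zero_right h0, norm_neg] at h1
      linarith
  obtain ⟨δ, hδ, hδ1, hHδ⟩ : ∃ δ : ℝ, 0 < δ ∧ δ ≤ 1 ∧ ∀ x, ‖x‖ ≤ 1 → δ ≤ ‖H x‖ := by
    obtain ⟨x₀, hx₀, hmin⟩ := (isCompact_closedBall (0 : E) 1).exists_isMinOn ⟨0, by simp⟩
      (hHlip.continuous.norm.continuousOn)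
    refine ⟨min 1 ‖H x₀‖, lt_min one_pos (norm_pos_iff.2 (hHne x₀ (by simpa using hx₀))),
      min_le_left _ _, fun x hx => (min_le_right _ _).trans (hmin (by simpa using hx))⟩
  refine not_lipschitz_retraction ((lipschitzWith_inv_max_norm_smul hδ).comp hHlip) ?_ ?_
  · intro x hx
    have h1 := hHδ x hx
    have h2 : ‖H x‖ ≠ 0 := (hδ.trans_le h1).ne'
    simp [max_eq_right h1, norm_smul, h2]
  · intro x hx
    have hHx : H x = x := by
      simp [H, unitBallProj_of_norm_le hx.le, φ, hx]
    simp [hHx, hx, max_eq_right hδ1]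

/-- A Lipschitz map close to the identity on the unit ball has an invertible derivative on
a set of positive measure. -/
theorem not_ae_det_fderiv_eq_zero {h : E → E} {C : ℝ≥0} (hh : LipschitzWith C h)
    (hclose : ∀ x, ‖x‖ ≤ 1 → ‖h x - x‖ ≤ 1 / 8) :
    ¬ ∀ᵐ x ∂(μH[finrank ℝ E] : Measure E), x ∈ ball 0 1 →
      ∃ A : E →L[ℝ] E, HasFDerivAt h A x ∧ A.det = 0 := by
  intro hae
  set μ : Measure E := μH[finrank ℝ E]
  set S : Set E := {x | x ∈ ball 0 1 → ∃ A : E →L[ℝ] E, HasFDerivAt h A x ∧ A.det = 0}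
  have h1 : μ (h '' Sᶜ) = 0 := hh.hausdorffMeasure_image_null (by positivity) hae
  have h2 : μ (h '' (ball 0 1 ∩ S)) = 0 :=
    addHaar_image_eq_zero_of_det_fderivWithin_eq_zero μ (f' := fderiv ℝ h)
      (fun x hx => by
        obtain ⟨A, hA, -⟩ := hx.2 hx.1
        exact hA.differentiableAt.hasFDerivAt.hasFDerivWithinAt)
      (fun x hx => by
        obtain ⟨A, hA, hdet⟩ := hx.2 hx.1
        rwa [hA.fderiv])
  have h3 : μ (h '' ball 0 1) = 0 := by
    refine measure_mono_null ?_ (measure_union_null h2 h1)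
    rw [← Set.image_union]
    refine Set.image_mono fun x hx => ?_
    by_cases hS : x ∈ S
    · exact Or.inl ⟨hx, hS⟩
    · exact Or.inr hS
  -- A null image misses some small y, but h − y is still within 1/4 of the identity and so has a
  -- zero.
  obtain ⟨y, hy, hyn⟩ : ∃ y ∈ ball (0 : E) (1 / 8), y ∉ h '' ball 0 1 := by
    by_contra! hcon
    exact (measure_ball_pos μ (0 : E) (by norm_num : (0 : ℝ) < 1 / 8)).ne'
      (measure_mono_null hcon h3)
  obtain ⟨x, hx, hx0⟩ := exists_zero_of_norm_sub_le (hh.sub (LipschitzWith.const y))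
    (fun x hx => by
      have e : h x - y - x = (h x - x) - y := by abel
      rw [e]
      have := mem_ball_zero_iff.1 hy
      have := norm_sub_le (h x - x) y
      linarith [hclose x hx])
  exact hyn ⟨x, mem_ball_zero_iff.2 (by linarith), sub_eq_zero.1 hx0⟩

/-- A Lipschitz map that is injective on the closed unit ball has an injective derivative at
some point of differentiability (indeed on a set of positive measure). -/
theorem not_injOn_of_ae_fderiv_not_injective {V : Type*} [NormedAddCommGroup V]
    [InnerProductSpace ℝ V] [FiniteDimensional ℝ V] {F : E → V} {C : ℝ≥0}
    (hF : LipschitzWith C F)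
    (hker : ∀ᵐ x ∂(μH[finrank ℝ E] : Measure E), x ∈ ball 0 1 →
      ∃ A : E →L[ℝ] V, HasFDerivAt F A x ∧ ∃ v ≠ 0, A v = 0) :
    ¬ Set.InjOn F (closedBall 0 1) := by
  intro hinj
  have hemb : IsClosedEmbedding ((closedBall (0 : E) 1).domRestrict F) := by
    have : CompactSpace (closedBall (0 : E) 1) :=
      isCompact_iff_compactSpace.1 (isCompact_closedBall _ _)
    exact (hF.continuous.comp continuous_subtype_val).isClosedEmbedding
      (Set.injOn_iff_injective.1 hinj)
  -- Tietze extends the inverse of F from the compact image to all of V; smoothing then makes the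
  -- chain rule available.
  obtain ⟨G₀, hG₀⟩ := ContinuousMap.exists_extension' hemb
    (⟨Subtype.val, continuous_subtype_val⟩ : C(closedBall (0 : E) 1, E))
  obtain ⟨G, hG, hGG, -⟩ := G₀.continuous.exists_contDiff_approx 1
    (ε := fun _ => 1 / 8) continuous_const (fun _ => by norm_num)
  obtain ⟨R, hR⟩ :=
    ((isCompact_closedBall (0 : E) 1).image hF.continuous).isBounded.subset_closedBall 0
  obtain ⟨M, hM⟩ := ((isCompact_closedBall (0 : V) R).image
    (hG.continuous_fderiv one_ne_zero)).isBounded.exists_norm_le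
  have hGlip : LipschitzOnWith (Real.toNNReal M) G (closedBall 0 R) :=
    (convex_closedBall _ _).lipschitzOnWith_of_nnnorm_fderiv_le
      (fun x _ => (hG.differentiable one_ne_zero) x)
      (fun x hx => by
        rw [← NNReal.coe_le_coe, coe_nnnorm]
        exact (hM _ ⟨x, hx, rfl⟩).trans (Real.le_coe_toNNReal M))
  have hlip : LipschitzWith (Real.toNNReal M * (C * 2)) (fun x => G (F (unitBallProj x))) := by
    rw [← lipschitzOnWith_univ]
    exact hGlip.comp ((hF.comp lipschitzWith_unitBallProj).lipschitzOnWith (s := Set.univ))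
      fun x _ => hR ⟨unitBallProj x, by simpa using norm_unitBallProj_le x, rfl⟩
  refine not_ae_det_fderiv_eq_zero hlip (fun x hx => ?_) ?_
  · have h1 := congrFun hG₀ ⟨x, by simpa using hx⟩
    simp only [Function.comp_apply, Set.domRestrict_apply, ContinuousMap.coe_mk] at h1
    have h2 := hGG (F x)
    rw [h1, dist_eq_norm] at h2
    simpa [unitBallProj_of_norm_le hx] using h2.le
  · filter_upwards [hker] with x hx hxb
    obtain ⟨A, hA, v, hv, hAv⟩ := hx hxb
    have hev : (fun x => G (F (unitBallProj x))) =ᶠ[𝓝 x] fun x => G (F x) := by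
      filter_upwards [isOpen_ball.mem_nhds hxb] with y hy
      rw [unitBallProj_of_norm_le (mem_ball_zero_iff.1 hy).le]
    refine ⟨(fderiv ℝ G (F x)).comp A, ?_, ?_⟩
    · exact (((hG.differentiable one_ne_zero) (F x)).hasFDerivAt.comp x hA).congr_of_eventuallyEq hev
    · by_contra hdet
      refine hv ?_
      have hinj' : Function.Injective ((fderiv ℝ G (F x)).comp A) :=
        (LinearMap.equivOfDetNeZero (((fderiv ℝ G (F x)).comp A : E →L[ℝ] E) : E →ₗ[ℝ] E) hdet).injective
      apply hinj'
      simp [hAv]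

end NoRetraction

/-! ### The weak contact condition and isotropy -/

section Contact

theorem abs_sub_le_of_forall_close {Ψ : ℝ → ℝ} {C δ : ℝ} (hδ : 0 < δ)
    (h : ∀ u v, u ∈ Set.Icc (0 : ℝ) 1 → v ∈ Set.Icc (0 : ℝ) 1 → |v - u| ≤ δ →
      |Ψ v - Ψ u| ≤ C * |v - u|) : |Ψ 1 - Ψ 0| ≤ C := by
  obtain ⟨N, hN⟩ := exists_nat_gt (1 / δ)
  have hN0 : (0 : ℝ) < N := (one_div_pos.2 hδ).trans hN
  have hstep : ∀ i ∈ Finset.range N,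
      |Ψ ((i + 1 : ℕ) / N) - Ψ ((i : ℕ) / N)| ≤ C * (1 / N) := by
    intro i hi
    have hiN : ((i + 1 : ℕ) : ℝ) ≤ N := by exact_mod_cast Finset.mem_range.1 hi
    have hiN' : (i : ℝ) ≤ N := le_trans (by push_cast; linarith) hiN
    have hd : ((i + 1 : ℕ) : ℝ) / N - (i : ℕ) / N = 1 / N := by
      push_cast; ring
    have habs : |((i + 1 : ℕ) : ℝ) / N - (i : ℕ) / N| = 1 / N := by
      rw [hd, abs_of_pos (by positivity)]
    rw [← habs]
    refine h _ _ ⟨by positivity, (div_le_one hN0).2 hiN'⟩ ⟨by positivity, (div_le_one hN0).2 hiN⟩ ?_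
    rw [habs]
    exact ((one_div_lt hδ hN0).1 hN).le
  calc |Ψ 1 - Ψ 0|
      = |∑ i ∈ Finset.range N, (Ψ ((i + 1 : ℕ) / N) - Ψ ((i : ℕ) / N))| := by
        rw [Finset.sum_range_sub (fun i : ℕ => Ψ ((i : ℝ) / N)), div_self hN0.ne']
        simp
    _ ≤ ∑ i ∈ Finset.range N, C * (1 / N) :=
        (Finset.abs_sum_le_sum_abs _ _).trans (Finset.sum_le_sum hstep)
    _ = C := by
        rw [Finset.sum_const, Finset.card_range, nsmul_eq_mul]
        field_simp

variable {E V : Type*} [NormedAddCommGroup E] [NormedSpace ℝ E] [NormedAddCommGroup V]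
  [NormedSpace ℝ V]

/-- If `z` is close to the linear map `L`, then the increments along segments of a function `τ`
which approximately satisfies `dτ = -ω(z, dz)` are close to those for `L`. -/
theorem abs_increment_segment_le {ω : V →L[ℝ] V →L[ℝ] ℝ} (hω : ∀ v, ω v v = 0) {z : E → V}
    {K : ℝ≥0} (hz : LipschitzWith K z) (L : E →L[ℝ] V) {τ : E → ℝ} {η ρ δ : ℝ}
    (hδ : 0 < δ) (hη : ∀ v, ‖v‖ ≤ ρ → ‖z v - L v‖ ≤ η)
    (hτ : ∀ v w, dist w v ≤ δ → |τ w - τ v + ω (z v) (z w)| ≤ η * dist w v)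
    {p q : E} (hp : ‖p‖ ≤ ρ) (hq : ‖q‖ ≤ ρ) :
    |(τ q + ω (L q) (z q - L q)) - (τ p + ω (L p) (z p - L p)) + ω (L p) (L q)| ≤
      (1 + ‖ω‖ * (3 * ‖L‖ + K)) * η * ‖q - p‖ := by
  have hanti : ∀ v w, ω v w = -ω w v := by
    intro v w
    have := hω (v + w)
    simp only [map_add, add_apply, hω] at this
    linarith
  set e : E → V := fun v => z v - L v with he
  -- A discrete integration by parts: the increments of e are not small compared with those of v,
  -- and this correction leaves only remainders carrying both a factor η and a factor ‖w − v‖.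
  set σ : E → ℝ := fun v => τ v + ω (L v) (e v) with hσ
  have hη0 : 0 ≤ η := (norm_nonneg _).trans (hη p hp)
  have hstep : ∀ v w, ‖v‖ ≤ ρ → ‖w‖ ≤ ρ → dist w v ≤ δ →
      |σ w - σ v + ω (L v) (L w)| ≤ (1 + ‖ω‖ * (3 * ‖L‖ + K)) * η * ‖w - v‖ := by
    intro v w hv hw hvw
    have hid : σ w - σ v + ω (L v) (L w) =
        (τ w - τ v + ω (z v) (z w)) + ω (L (w - v)) (e w) + ω (L (w - v)) (e v)
          - ω (e v) (e w - e v) := by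
      have hzv : z v = L v + e v := by simp [e]
      have hzw : z w = L w + e w := by simp [e]
      rw [hzv, hzw]
      simp only [σ, map_add, map_sub, add_apply, sub_apply,
        hω]
      rw [hanti (e v) (L w)]
      ring
    have hb : ∀ a b, |ω a b| ≤ ‖ω‖ * ‖a‖ * ‖b‖ := fun a b => ω.le_opNorm₂ a b
    have h1 := hτ v w hvw
    rw [dist_eq_norm] at h1
    have hL := L.le_opNorm (w - v)
    have hev := hη v hv
    have hew := hη w hw
    have h2 : |ω (L (w - v)) (e w)| ≤ ‖ω‖ * (‖L‖ * ‖w - v‖) * η :=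
      (hb _ _).trans (by gcongr)
    have h3 : |ω (L (w - v)) (e v)| ≤ ‖ω‖ * (‖L‖ * ‖w - v‖) * η :=
      (hb _ _).trans (by gcongr)
    have hde : ‖e w - e v‖ ≤ (K + ‖L‖) * ‖w - v‖ := by
      have : e w - e v = (z w - z v) - L (w - v) := by
        simp only [e, map_sub]; abel
      rw [this]
      refine (norm_sub_le _ _).trans ?_
      have := hz.dist_le_mul w v
      rw [dist_eq_norm, dist_eq_norm] at this
      linarith
    have h4 : |ω (e v) (e w - e v)| ≤ ‖ω‖ * η * ((K + ‖L‖) * ‖w - v‖) :=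
      (hb _ _).trans (by gcongr)
    rw [hid]
    calc _ ≤ η * ‖w - v‖ + ‖ω‖ * (‖L‖ * ‖w - v‖) * η + ‖ω‖ * (‖L‖ * ‖w - v‖) * η
          + ‖ω‖ * η * ((K + ‖L‖) * ‖w - v‖) := by
          refine (abs_sub _ _).trans (add_le_add ((abs_add_le _ _).trans
            (add_le_add ((abs_add_le _ _).trans (add_le_add h1 h2)) h3)) h4)
      _ = _ := by ring
  set c : ℝ → E := fun u => p + u • (q - p) with hc
  have hcρ : ∀ u ∈ Set.Icc (0 : ℝ) 1, ‖c u‖ ≤ ρ := by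
    intro u hu
    have : c u = (1 - u) • p + u • q := by simp only [c]; module
    rw [this]
    refine (norm_add_le _ _).trans ?_
    rw [norm_smul, norm_smul, Real.norm_of_nonneg (sub_nonneg.2 hu.2), Real.norm_of_nonneg hu.1]
    nlinarith [hu.1, hu.2]
  have hcd : ∀ u v, c v - c u = (v - u) • (q - p) := fun u v => by simp only [c]; module
  -- On a segment the form is linear in the increment of the parameter, so the small steps add up
  -- exactly.
  have hωc : ∀ u v, ω (L (c u)) (L (c v)) = (v - u) * ω (L p) (L q) := by
    intro u v
    simp only [c, map_add, map_smul, map_sub, add_apply,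
      sub_apply, smul_apply, hω, smul_eq_mul]
    rw [hanti (L q) (L p)]
    ring
  have hmain := abs_sub_le_of_forall_close
    (Ψ := fun u => σ (c u) + u * ω (L p) (L q)) (δ := δ / (‖q - p‖ + 1))
    (C := (1 + ‖ω‖ * (3 * ‖L‖ + K)) * η * ‖q - p‖) (by positivity) (by
      intro u v hu hv huv
      have hdist : ‖c v - c u‖ = |v - u| * ‖q - p‖ := by
        rw [hcd, norm_smul, Real.norm_eq_abs]
      have hle : dist (c v) (c u) ≤ δ := by
        rw [dist_eq_norm, hdist]
        rw [le_div_iff₀ (by positivity)] at huv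
        nlinarith [abs_nonneg (v - u)]
      have h := hstep (c u) (c v) (hcρ u hu) (hcρ v hv) hle
      rw [hωc, hdist] at h
      calc _ = |σ (c v) - σ (c u) + (v - u) * ω (L p) (L q)| := by congr 1; ring
        _ ≤ _ := h
        _ = _ := by ring)
  have hc0 : c 0 = p := by simp [c]
  have hc1 : c 1 = q := by simp [c]
  simp only [hc0, hc1, one_mul, zero_mul, add_zero] at hmain
  rwa [add_sub_right_comm] at hmain

/-- A Lipschitz map satisfying the weak contact condition has isotropic derivatives. -/
theorem isotropic_fderiv_of_contact {ω : V →L[ℝ] V →L[ℝ] ℝ} (hω : ∀ v, ω v v = 0) {F : E → V}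
    {K : ℝ≥0} (hF : LipschitzWith K F) {τ : E → ℝ}
    (hτ : ∀ ε > 0, ∃ δ > 0, ∀ x y, dist x y ≤ δ →
      |τ x - τ y + ω (F y) (F x)| ≤ ε * dist x y)
    {x₀ : E} {L : E →L[ℝ] V} (hL : HasFDerivAt F L x₀) (a b : E) : ω (L a) (L b) = 0 := by
  have hanti : ∀ v w, ω v w = -ω w v := by
    intro v w
    have := hω (v + w)
    simp only [map_add, add_apply, hω] at this
    linarith
  -- In the Heisenberg case this is left translation by the inverse of f(x₀), up to a constant in T;
  -- it preserves the contact defect.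
  set z : E → V := fun v => F (x₀ + v) - F x₀ with hz
  set T : E → ℝ := fun v => τ (x₀ + v) + ω (F x₀) (F (x₀ + v)) with hT
  have hzlip : LipschitzWith K z := by
    refine LipschitzWith.of_dist_le_mul fun v w => ?_
    simpa [z] using hF.dist_le_mul (x₀ + v) (x₀ + w)
  have hTz : ∀ v w, T w - T v + ω (z v) (z w) =
      τ (x₀ + w) - τ (x₀ + v) + ω (F (x₀ + v)) (F (x₀ + w)) := by
    intro v w
    simp only [T, z, map_sub, sub_apply, hω]
    rw [hanti (F (x₀ + v)) (F x₀)]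
    ring
  set M := ‖a‖ + ‖b‖ + 1 with hM
  have hM0 : 0 < M := by positivity
  have hna := norm_nonneg a
  have hnb := norm_nonneg b
  set C := 1 + ‖ω‖ * (3 * ‖L‖ + K) with hC
  have hC0 : 0 < C := by positivity
  have key : ∀ η > 0, |ω (L a) (L b)| ≤ 3 * C * M ^ 2 * η := by
    intro η hη
    obtain ⟨ρ, hρ, hLρ⟩ : ∃ ρ > 0, ∀ v, ‖v‖ ≤ ρ → ‖z v - L v‖ ≤ η * ‖v‖ := by
      have := (hasFDerivAt_iff_isLittleO_nhds_zero.1 hL).def hη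
      obtain ⟨ρ, hρ, h⟩ := Metric.eventually_nhds_iff.1 this
      exact ⟨ρ / 2, by positivity, fun v hv => h (by rw [dist_zero_right]; linarith)⟩
    obtain ⟨δ, hδ, hτδ⟩ := hτ (η * ρ) (by positivity)
    -- This scale keeps the vertices and edges of the triangle 0, sa, sb within ρ.
    set s := ρ / M with hs
    have hs0 : 0 < s := by positivity
    have hsM : s * M = ρ := by simp only [s]; field_simp
    have hseg : ∀ p q, ‖p‖ ≤ ρ → ‖q‖ ≤ ρ → ‖q - p‖ ≤ ρ →
        |(T q + ω (L q) (z q - L q)) - (T p + ω (L p) (z p - L p)) + ω (L p) (L q)| ≤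
          C * (η * ρ) * ρ := by
      intro p q hp hq hpq
      refine (abs_increment_segment_le hω hzlip L hδ (η := η * ρ) (ρ := ρ)
        (fun v hv => (hLρ v hv).trans (by gcongr)) (fun v w hvw => ?_) hp hq).trans
        (by gcongr)
      rw [hTz]
      have := hτδ (x₀ + w) (x₀ + v) (by simpa using hvw)
      simpa using this
    have hsa : ‖s • a‖ ≤ ρ := by
      rw [norm_smul, Real.norm_of_nonneg hs0.le, ← hsM]
      gcongr
      linarith
    have hsb : ‖s • b‖ ≤ ρ := by
      rw [norm_smul, Real.norm_of_nonneg hs0.le, ← hsM]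
      gcongr
      linarith
    have hsab : ‖s • b - s • a‖ ≤ ρ := by
      rw [← smul_sub, norm_smul, Real.norm_of_nonneg hs0.le, ← hsM]
      gcongr
      linarith [norm_sub_le b a]
    have h1 := hseg 0 (s • a) (by simpa using hρ.le) hsa (by simpa using hsa)
    have h2 := hseg (s • a) (s • b) hsa hsb hsab
    have h3 := hseg (s • b) 0 hsb (by simpa using hρ.le) (by simpa using hsb)
    -- Around the closed triangle the increments of the corrected function cancel, leaving s²ω(La,
    -- Lb). The error is of order ηρ² = ηM²s², so s² divides out.
    have h4 : s ^ 2 * |ω (L a) (L b)| ≤ 3 * (C * (η * ρ) * ρ) := by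
      rw [← abs_of_pos (by positivity : 0 < s ^ 2), ← abs_mul]
      have hh := (abs_add_three _ _ _).trans (add_le_add (add_le_add h1 h2) h3)
      refine (le_of_eq ?_).trans (hh.trans_eq (by ring))
      congr 1
      simp only [map_smul, map_zero, smul_apply, zero_apply,
        smul_eq_mul]
      ring
    rw [← hsM] at h4
    have h5 : s ^ 2 * |ω (L a) (L b)| ≤ s ^ 2 * (3 * C * M ^ 2 * η) := h4.trans_eq (by ring)
    exact le_of_mul_le_mul_left h5 (by positivity)
  have h0 : |ω (L a) (L b)| ≤ 0 := by
    refine le_of_forall_pos_le_add fun ε hε => ?_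
    refine (key (ε / (3 * C * M ^ 2)) (by positivity)).trans_eq ?_
    field_simp
    simp
  exact abs_eq_zero.1 (le_antisymm h0 (abs_nonneg _))

/-- The contact equation at points of differentiability. -/
theorem contact_eq_of_hasFDerivAt {ω : V →L[ℝ] V →L[ℝ] ℝ} (hω : ∀ v, ω v v = 0) {F : E → V}
    {τ : E → ℝ} (hτ : ∀ ε > 0, ∃ δ > 0, ∀ x y, dist x y ≤ δ →
      |τ x - τ y + ω (F y) (F x)| ≤ ε * dist x y)
    {x₀ : E} {L : E →L[ℝ] V} (hL : HasFDerivAt F L x₀) {l : E →L[ℝ] ℝ} (hl : HasFDerivAt τ l x₀)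
    (v : E) : l v = -ω (F x₀) (L v) := by
  have h1 : HasFDerivAt (fun x => τ x + ω (F x₀) (F x)) (l + (ω (F x₀)).comp L) x₀ :=
    hl.add ((ω (F x₀)).hasFDerivAt.comp x₀ hL)
  -- Since ω(F x₀, F x₀) = 0, the contact condition says exactly that this function changes by o(|x
  -- − x₀|).
  have h2 : HasFDerivAt (fun x => τ x + ω (F x₀) (F x)) (0 : E →L[ℝ] ℝ) x₀ := by
    rw [hasFDerivAt_iff_isLittleO, Asymptotics.isLittleO_iff]
    intro ε hε
    obtain ⟨δ, hδ, h⟩ := hτ ε hε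
    filter_upwards [closedBall_mem_nhds x₀ hδ] with x hx
    have := h x x₀ hx
    rw [dist_eq_norm] at this
    simp only [hω, add_zero, zero_apply, sub_zero, Real.norm_eq_abs]
    rwa [add_sub_right_comm]
  have h3 := congrArg (fun A : E →L[ℝ] ℝ => A v) (h1.unique h2)
  simp only [add_apply, ContinuousLinearMap.comp_apply,
    zero_apply] at h3
  linarith

end Contact

/-! ### Linear algebra of isotropic maps -/

section Isotropic

open Module

/-- An isotropic linear map into the symplectic space `ℝ²ⁿ` has rank at most `n`. -/
theorem exists_ne_zero_of_isotropic {n : ℕ} {E : Type*} [AddCommGroup E] [Module ℝ E]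
    [FiniteDimensional ℝ E] (hn : n < finrank ℝ E)
    (A : E →ₗ[ℝ] EuclideanSpace ℝ (Fin n ⊕ Fin n))
    (hA : ∀ a b, ∑ j, (A a (.inl j) * A b (.inr j) - A a (.inr j) * A b (.inl j)) = 0) :
    ∃ v ≠ 0, A v = 0 := by
  by_contra! hne
  have hinj : Function.Injective A := by
    rw [← LinearMap.ker_eq_bot, LinearMap.ker_eq_bot']
    exact fun v hv => by_contra fun h => hne v h hv
  -- The complex structure: ⟨J u, w⟩ is the symplectic form, so isotropy puts J(range A) in the
  -- orthogonal complement of range A, whence 2 dim E ≤ 2n.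
  let J : EuclideanSpace ℝ (Fin n ⊕ Fin n) →ₗ[ℝ] EuclideanSpace ℝ (Fin n ⊕ Fin n) :=
    { toFun := fun w => WithLp.toLp 2 (Sum.elim (fun j => -w (.inr j)) fun j => w (.inl j))
      map_add' := fun v w => by
        ext i
        rcases i with i | i <;> simp [add_comm]
      map_smul' := fun c w => by
        ext i
        rcases i with i | i <;> simp }
  have hJ : Function.Injective J := by
    rw [← LinearMap.ker_eq_bot, LinearMap.ker_eq_bot']
    intro w hw
    ext i
    rcases i with i | i
    · simpa [J] using congrArg (fun u : EuclideanSpace ℝ (Fin n ⊕ Fin n) => u (.inr i)) hw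
    · simpa [J] using congrArg (fun u : EuclideanSpace ℝ (Fin n ⊕ Fin n) => u (.inl i)) hw
  have hle : LinearMap.range (J ∘ₗ A) ≤ (LinearMap.range A)ᗮ := by
    rintro _ ⟨a, rfl⟩
    rw [Submodule.mem_orthogonal]
    rintro _ ⟨b, rfl⟩
    rw [real_inner_comm, PiLp.inner_apply, Fintype.sum_sum_type, ← hA a b, Finset.sum_sub_distrib]
    simp [J, mul_comm]
    ring
  have h1 := Submodule.finrank_mono hle
  have h2 := Submodule.finrank_add_finrank_orthogonal (LinearMap.range A)
  rw [LinearMap.finrank_range_of_inj (f := J ∘ₗ A) (hJ.comp hinj)] at h1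
  rw [LinearMap.finrank_range_of_inj hinj, finrank_euclideanSpace, Fintype.card_sum,
    Fintype.card_fin] at h2
  omega

end Isotropic

/-- Squaring turns exponent 1/2 into 1, the form in which the vertical increment is controlled. -/
theorem IsLittleHolder.exists_dist_sq_le {X Y : Type*} [MetricSpace X] [MetricSpace Y] {f : X → Y}
    (hf : IsLittleHolder (1 / 2) f) {ε : ℝ} (hε : 0 < ε) :
    ∃ δ > 0, ∀ x y, dist x y ≤ δ → dist (f x) (f y) ^ 2 ≤ ε * dist x y := by
  have hs : 0 < √ε := Real.sqrt_pos.2 hε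
  obtain ⟨δ, hδ, hδ0⟩ := ((hf.eventually (gt_mem_nhds (ENNReal.ofReal_pos.2 hs))).and
    self_mem_nhdsWithin).exists
  refine ⟨δ, hδ0, fun x y hxy => ?_⟩
  rcases eq_or_ne x y with rfl | hne
  · simp
  · have hpos : 0 < dist x y := dist_pos.2 hne
    have h1 : ENNReal.ofReal (dist (f x) (f y) / dist x y ^ (1 / 2 : ℝ)) < ENNReal.ofReal √ε :=
      by
      refine lt_of_le_of_lt ?_ hδ
      exact le_iSup_of_le x (le_iSup_of_le y (le_iSup_of_le ⟨hpos, hxy⟩ le_rfl))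
    have h2 := (ENNReal.ofReal_lt_ofReal_iff hs).1 h1
    rw [← Real.sqrt_eq_rpow, div_lt_iff₀ (Real.sqrt_pos.2 hpos)] at h2
    calc dist (f x) (f y) ^ 2 ≤ (√ε * √(dist x y)) ^ 2 := by gcongr
      _ = ε * dist x y := by rw [mul_pow, Real.sq_sqrt hε.le, Real.sq_sqrt hpos.le]

/-! ### Application to the Heisenberg group -/

namespace Heisenberg

variable {n : ℕ}

theorem abs_t_le_dist_sq (p q : Heisenberg n) : |(q⁻¹ * p).t| ≤ dist p q ^ 2 := by
  refine abs_le_of_sq_le_sq ?_ (by positivity)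
  have h := gauge_pow_four (q⁻¹ * p)
  have hd : dist p q = gauge (q⁻¹ * p) := rfl
  rw [hd, ← pow_mul, h]
  nlinarith [sq_nonneg (‖(q⁻¹ * p).x‖ ^ 2 + ‖(q⁻¹ * p).y‖ ^ 2)]

theorem toEuclidean_injective : Function.Injective (toEuclidean (n := n)) := by
  intro p q h
  have hi : ∀ i, toEuclidean p i = toEuclidean q i := fun i => by rw [h]
  ext j
  · exact hi (.inl j)
  · exact hi (.inr (.inl j))
  · exact hi (.inr (.inr ()))

/-- The coordinate functions on `ℝ²ⁿ⁺¹`. -/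
noncomputable def coord (i : Fin n ⊕ Fin n ⊕ Unit) :
    EuclideanSpace ℝ (Fin n ⊕ Fin n ⊕ Unit) →L[ℝ] ℝ :=
  EuclideanSpace.proj i

theorem coord_apply (i : Fin n ⊕ Fin n ⊕ Unit) (p : EuclideanSpace ℝ (Fin n ⊕ Fin n ⊕ Unit)) :
    coord i p = p i := rfl

/-- The bilinear form `ω(p, q) = 2 ∑ⱼ (xⱼ(p) yⱼ(q) - yⱼ(p) xⱼ(q))` on `ℝ²ⁿ⁺¹`. -/
noncomputable def contactForm (n : ℕ) :
    EuclideanSpace ℝ (Fin n ⊕ Fin n ⊕ Unit) →L[ℝ]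
      EuclideanSpace ℝ (Fin n ⊕ Fin n ⊕ Unit) →L[ℝ] ℝ :=
  (2 : ℝ) • ∑ j : Fin n, ((coord (.inl j)).smulRight (coord (.inr (.inl j))) -
    (coord (.inr (.inl j))).smulRight (coord (.inl j)))

theorem contactForm_apply (p q : EuclideanSpace ℝ (Fin n ⊕ Fin n ⊕ Unit)) :
    contactForm n p q =
      2 * ∑ j, (p (.inl j) * q (.inr (.inl j)) - p (.inr (.inl j)) * q (.inl j)) := by
  simp [contactForm, coord_apply]

theorem contactForm_self (p : EuclideanSpace ℝ (Fin n ⊕ Fin n ⊕ Unit)) :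
    contactForm n p p = 0 := by
  simp [contactForm_apply, mul_comm]

theorem inv_mul_t_eq (p q : Heisenberg n) :
    (q⁻¹ * p).t = p.t - q.t + contactForm n (toEuclidean q) (toEuclidean p) := by
  rw [contactForm_apply]
  simp only [mul_t, inv_t, inv_x, inv_y, toEuclidean, Sum.elim_inl, Sum.elim_inr, PiLp.neg_apply]
  rw [neg_add_eq_sub]
  congr 2
  exact Finset.sum_congr rfl fun j _ => by ring

open MeasureTheory Module in
/-- A map into the Heisenberg group which is `1/2`-little Hölder and Lipschitz for the Euclidean
metric cannot be injective on the unit ball of a space of dimension at least `n + 1`. -/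
theorem not_injOn_of_contact {E : Type*} [NormedAddCommGroup E] [InnerProductSpace ℝ E]
    [FiniteDimensional ℝ E] (hn : n < finrank ℝ E) {f : E → Heisenberg n} {K : ℝ≥0}
    (hlip : LipschitzWith K (toEuclidean ∘ f))
    (hf : ∀ ε > 0, ∃ δ > 0, ∀ x y, dist x y ≤ δ → dist (f x) (f y) ^ 2 ≤ ε * dist x y) :
    ¬ Set.InjOn f (closedBall 0 1) := by
  intro hinj
  borelize E
  have hτ : ∀ ε > 0, ∃ δ > 0, ∀ x y, dist x y ≤ δ →
      |(f x).t - (f y).t + contactForm n ((toEuclidean ∘ f) y) ((toEuclidean ∘ f) x)| ≤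
        ε * dist x y := by
    intro ε hε
    obtain ⟨δ, hδ, h⟩ := hf ε hε
    refine ⟨δ, hδ, fun x y hxy => ?_⟩
    have h1 := abs_t_le_dist_sq (f x) (f y)
    rw [inv_mul_t_eq] at h1
    exact h1.trans (h x y hxy)
  refine not_injOn_of_ae_fderiv_not_injective hlip ?_ (toEuclidean_injective.comp_injOn hinj)
  filter_upwards [hlip.ae_differentiableAt (μ := μH[finrank ℝ E])] with x hx _
  refine ⟨_, hx.hasFDerivAt, ?_⟩
  set L := fderiv ℝ (toEuclidean ∘ f) x
  have hiso := isotropic_fderiv_of_contact contactForm_self hlip hτ hx.hasFDerivAt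
  have hlt : HasFDerivAt (fun y => (f y).t)
      ((coord (.inr (.inr ()))).comp L) x :=
    (coord (.inr (.inr ()))).hasFDerivAt.comp x hx.hasFDerivAt
  have ht := contact_eq_of_hasFDerivAt contactForm_self hτ (L := L) hx.hasFDerivAt hlt
  let A : E →ₗ[ℝ] EuclideanSpace ℝ (Fin n ⊕ Fin n) :=
    { toFun := fun v => WithLp.toLp 2
        (Sum.elim (fun j => L v (.inl j)) fun j => L v (.inr (.inl j)))
      map_add' := fun v w => by
        ext i
        rcases i with i | i <;> simp
      map_smul' := fun c w => by
        ext i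
        rcases i with i | i <;> simp }
  obtain ⟨v, hv, hAv⟩ := exists_ne_zero_of_isotropic hn A fun a b => by
    have := hiso a b
    rw [contactForm_apply] at this
    simpa [A] using this
  refine ⟨v, hv, ?_⟩
  have hx0 : ∀ j, L v (.inl j) = 0 := fun j => by
    simpa [A] using congrArg (fun u : EuclideanSpace ℝ (Fin n ⊕ Fin n) => u (.inl j)) hAv
  have hy0 : ∀ j, L v (.inr (.inl j)) = 0 := fun j => by
    simpa [A] using congrArg (fun u : EuclideanSpace ℝ (Fin n ⊕ Fin n) => u (.inr j)) hAv
  -- The contact equation expresses the vertical component through the horizontal ones, which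
  -- vanish.
  have ht0 : L v (.inr (.inr ())) = 0 := by
    have := ht v
    rw [contactForm_apply] at this
    simpa [hx0, hy0, coord_apply] using this
  ext i
  rcases i with i | i | i
  · exact hx0 i
  · exact hy0 i
  · exact ht0

/-- Precomposing with the projection followed by halving extends f to the whole space and sends the
closed unit ball into the open one, so both kinds of ball are covered. -/
theorem not_injective_of_ball_subset {m : ℕ} (hmn : n + 1 ≤ m)
    {s : Set (EuclideanSpace ℝ (Fin m))} (hs : ball 0 1 ⊆ s) {f : s → Heisenberg n}
    (hf : IsLittleHolder (1 / 2) f) (hlip : IsHolder 1 (toEuclidean ∘ f)) :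
    ¬ Function.Injective f := by
  intro hinj
  obtain ⟨C, hC⟩ := hlip
  rw [holderWith_one] at hC
  let c : EuclideanSpace ℝ (Fin m) → s := fun x => ⟨(1 / 2 : ℝ) • unitBallProj x, hs (by
    rw [mem_ball_zero_iff, norm_smul]
    have := norm_unitBallProj_le x
    norm_num
    linarith)⟩
  have hc : ∀ x y, dist (c x) (c y) ≤ dist x y := by
    intro x y
    have h := (lipschitzWith_unitBallProj (E := EuclideanSpace ℝ (Fin m))).dist_le_mul x y
    rw [Subtype.dist_eq, dist_smul₀]
    norm_num at h ⊢
    linarith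
  refine not_injOn_of_contact (f := f ∘ c) (by simpa using hmn)
    (hC.comp (LipschitzWith.of_dist_le' (K := 1) fun x y => by simpa using hc x y)) ?_ ?_
  · intro ε hε
    obtain ⟨δ, hδ, h⟩ := hf.exists_dist_sq_le hε
    exact ⟨δ, hδ, fun x y hxy => (h _ _ ((hc x y).trans hxy)).trans
      (mul_le_mul_of_nonneg_left (hc x y) hε.le)⟩
  · intro x hx y hy hxy
    have h := congrArg Subtype.val (hinj hxy)
    simp only [c] at h
    rw [unitBallProj_of_norm_le (mem_closedBall_zero_iff.1 hx),
      unitBallProj_of_norm_le (mem_closedBall_zero_iff.1 hy)] at h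
    exact smul_right_injective _ (by norm_num : (1 / 2 : ℝ) ≠ 0) h

end Heisenberg

theorem corollary4 (m n : ℕ) (hmn : n + 1 ≤ m) :
    (¬ ∃ f : ball (0 : EuclideanSpace ℝ (Fin m)) 1 → Heisenberg n,
      IsEmbedding f ∧ IsLittleHolder (1 / 2) f ∧ IsHolder 1 (Heisenberg.toEuclidean ∘ f)) ∧
    (¬ ∃ f : closedBall (0 : EuclideanSpace ℝ (Fin m)) 1 → Heisenberg n,
      IsEmbedding f ∧ IsLittleHolder (1 / 2) f ∧ IsHolder 1 (Heisenberg.toEuclidean ∘ f)) := by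
  constructor
  · rintro ⟨f, hf, hlittle, hlip⟩
    exact Heisenberg.not_injective_of_ball_subset hmn subset_rfl hlittle hlip hf.injective
  · rintro ⟨f, hf, hlittle, hlip⟩
    exact Heisenberg.not_injective_of_ball_subset hmn ball_subset_closedBall hlittle hlip
      hf.injective
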